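/- Let $\mathbb R^n_+$ be the set of entrywise nonnegative vectors. For $x,y\in\mathbb R^n_+$ write $x\sim y$ if $cy\le x\le Cy$ entrywise for some $c,C>0$, and put $M(x/y)=\inf\{C>0: x\le Cy\}$. Hilbert's projective metric on $\mathbb R^n_+$ is $d_H(0,0)=0$, $d_H(x,y)=\ln\big(M(x/y)M(y/x)\big)$ if $x\sim y$ and $x,y\ne 0$, and $d_H(x,y)=\infty$ otherwise. The Birkhoff contraction ratio of a nonnegative $n\times n$ matrix $A$ is $$\kappa_H(A)=\inf\{C>0:\ d_H(Ax,Ay)\le C\,d_H(x,y)\ \text{ for all } x,y\in\mathbb R^n_+ \text{ with } x\sim y\}.$$ Theorem. Let $M\in\mathbb R^{n\times n}$ be a (row-)stochastic matrix, that is, $M$ is entrywise nonnegative and $M\mathbf 1=\mathbf 1$, and let $\pi\in\mathbb R^n$ be a probability vector with positive entries such that $\pi^TM=\pi^T$. Let $M^*=D_\pi^{-1}M^TD_\pi$, where $D_\pi=\mathrm{diag}(\pi)$, be the adjoint of $M$ with respect to the inner product $\langle x,y\rangle_\pi=\sum_i\pi_ix_iy_i$. If $MM^*$ is irreducible, then $$\|M\|_{\pi,2\to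 q}=1\qquad\text{for every real } q \text{ with } 1\le q\le 1+\kappa_H(MM^*)^{-1},$$ where $\|x\|_{\pi,p}=\big(\sum_{i=1}^n\pi_i|x_i|^p\big)^{1/p}$ and $\|M\|_{\pi,p\to q}=\max_{x\in\mathbb R^n,\,x\neq 0}\|Mx\|_{\pi,q}/\|x\|_{\pi,p}$, and where $\kappa_H(MM^*)^{-1}=\infty$ if $\kappa_H(MM^*)=0$ (so that every real $q\ge 1$ is then allowed). -/

import Mathlib

open scoped ENNReal

noncomputable section

namespace MarkovNorm

variable {ι κ : Type*}

/-- `x ∼ y`: two vectors of the nonnegative orthant are comparable if `c y ≤ x ≤ C y`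
(entrywise) for some `c, C > 0`. -/
def Comparable (x y : ι → ℝ) : Prop :=
  0 ≤ x ∧ 0 ≤ y ∧ ∃ c C : ℝ, 0 < c ∧ 0 < C ∧ c • y ≤ x ∧ x ≤ C • y

/-- `M(x/y) = inf {C > 0 : x ≤ C y}`. -/
def upperRatio (x y : ι → ℝ) : ℝ := sInf {C : ℝ | 0 < C ∧ x ≤ C • y}

open Classical in
/-- Hilbert's projective metric on the nonnegative orthant, with values in `[0, ∞]`:
it is `0` if `x = y = 0`, it is `log (M(x/y) M(y/x))` if `x ∼ y` are nonzero (the logarithm is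
then nonnegative, as `M(x/y) M(y/x) ≥ 1`), and it is `∞` otherwise. -/
def hilbertDist (x y : ι → ℝ) : ℝ≥0∞ :=
  if x = 0 ∧ y = 0 then 0
  else if Comparable x y then ENNReal.ofReal (Real.log (upperRatio x y * upperRatio y x))
  else ∞

/-- The Birkhoff contraction ratio in `[0, ∞]` of a map between nonnegative orthants: the
infimum (`∞` for the empty set) of all real `C > 0` such that `d_H(F x, F y) ≤ C d_H(x, y)` for
all comparable `x, y`. Only the values of `F` on the nonnegative orthant matter. -/
def birkhoffRatio (F : (ι → ℝ) → (κ → ℝ)) : ℝ≥0∞ :=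
  sInf {K : ℝ≥0∞ | ∃ C : ℝ, 0 < C ∧ K = ENNReal.ofReal C ∧
    ∀ x y : ι → ℝ, Comparable x y →
      hilbertDist (F x) (F y) ≤ ENNReal.ofReal C * hilbertDist x y}

variable [Fintype ι]

/-- The Birkhoff contraction ratio of (the linear map of) a nonnegative matrix. -/
def matrixBirkhoffRatio (A : Matrix κ ι ℝ) : ℝ≥0∞ :=
  birkhoffRatio (fun x : ι → ℝ => A.mulVec x)

/-- The adjoint `M^* = D_π⁻¹ Mᵀ D_π` of `M` with respect to `⟨x, y⟩_π = ∑ i, π i * x i * y i`,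
for a vector `π` with positive entries. -/
def weightedAdjoint [DecidableEq ι] (π : ι → ℝ) (M : Matrix ι ι ℝ) : Matrix ι ι ℝ :=
  (Matrix.diagonal π)⁻¹ * M.transpose * Matrix.diagonal π

/-- The weighted `ℓ^p` norm `(∑ i, π i |x i|^p)^(1/p)`, for finite `p ≥ 1`. -/
def weightedNorm (π : ι → ℝ) (p : ℝ) (x : ι → ℝ) : ℝ :=
  (∑ i, π i * |x i| ^ p) ^ (1 / p)

/-- The set of all quotients `‖M x‖_{π,q} / ‖x‖_{π,p}` with `x ≠ 0`. -/
def weightedQuotients (π : ι → ℝ) (p q : ℝ) (M : Matrix ι ι ℝ) : Set ℝ :=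
  {r : ℝ | ∃ x : ι → ℝ, x ≠ 0 ∧ r = weightedNorm π q (M.mulVec x) / weightedNorm π p x}

/-- The weighted matrix norm `‖M‖_{π,p→q}`, the maximum of `‖M x‖_{π,q} / ‖x‖_{π,p}` over
`x ≠ 0`. -/
def weightedOpNorm (π : ι → ℝ) (p q : ℝ) (M : Matrix ι ι ℝ) : ℝ :=
  sSup (weightedQuotients π p q M)

end MarkovNorm

end

namespace MarkovNorm

/-! As `M ≥ 0`, only `x ≥ 0` on the unit sphere of `‖·‖_{π,2}` matters. For `r > 1`, let `u`
maximize `∑ π (M x) ^ r` there and put `y = M u`. By convexity `u` also maximizes the linear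
functional `⟨g, ·⟩_π` with `g = M^* y ^ (r - 1)`, so the equality case of Cauchy–Schwarz gives `g =
N u`. Applying `M` yields `M M^* y ^ (r - 1) = N y`, and irreducibility makes `y` positive
(`pos_of_isIrreducible`). The power map multiplies the Hilbert distance to `1` by `r - 1`, while `M
M^*` fixes `1`; if `(r - 1) κ_H(M M^*) < 1`, then `y` is at distance `0` from `1`
(`eq_const_of_birkhoffRatio_lt`). Hence `u = 1` and the maximum is `1`. The endpoint exponent
follows by continuity in `r`. -/

/-- The tangent line of the convex function `t ↦ t ^ r` at `s` lies below it on `[0, ∞)`. -/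
lemma rpow_tangent_le {r s t : ℝ} (hr : 1 < r) (hs : 0 ≤ s) (ht : 0 ≤ t) :
    s ^ r + r * (s ^ (r - 1) * (t - s)) ≤ t ^ r := by
  rcases hs.eq_or_lt with rfl | hs
  · rw [Real.zero_rpow (by linarith), Real.zero_rpow (by linarith)]
    simpa using Real.rpow_nonneg ht r
  · have h := one_add_mul_self_le_rpow_one_add (s := t / s - 1)
      (by linarith [div_nonneg ht hs.le]) hr.le
    rw [add_sub_cancel, Real.div_rpow ht hs.le, le_div_iff₀ (Real.rpow_pos_of_pos hs r)] at h
    have e : s ^ r = s ^ (r - 1) * s := by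
      rw [← Real.rpow_add_one hs.ne']; simp
    calc s ^ r + r * (s ^ (r - 1) * (t - s))
        = (1 + r * (t / s - 1)) * s ^ r := by rw [e]; field_simp
      _ ≤ t ^ r := h

/-! ### Hilbert distance to `1` and its contraction. -/

section Hilbert

variable {ι : Type*}

/-- The Hilbert distance of a positive vector to `1` in terms of its extreme entries. -/
lemma hilbertDist_one {y : ι → ℝ} {a b : ℝ} {i₀ i₁ : ι} (hb : 0 < b) (h₀ : y i₀ = b)
    (h₁ : y i₁ = a) (hby : ∀ i, b ≤ y i) (hya : ∀ i, y i ≤ a) :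
    hilbertDist y 1 = ENNReal.ofReal (Real.log (a / b)) := by
  have ha : 0 < a := hb.trans_le (h₁ ▸ hby i₁)
  have hcomp : Comparable y 1 :=
    ⟨fun i => hb.le.trans (hby i), fun _ => zero_le_one, b, a, hb, ha,
      fun i => by simpa using hby i, fun i => by simpa using hya i⟩
  have hne : ¬ (y = 0 ∧ (1 : ι → ℝ) = 0) := fun h => by
    simpa using congrFun h.2 i₀
  have hU : upperRatio y 1 = a := by
    refine IsLeast.csInf_eq ⟨⟨ha, fun i => by simpa using hya i⟩, fun C hC => ?_⟩
    simpa [h₁] using hC.2 i₁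
  have hL : upperRatio 1 y = b⁻¹ := by
    refine IsLeast.csInf_eq ⟨⟨inv_pos.2 hb, fun i => ?_⟩, fun C hC => ?_⟩
    · simpa [inv_mul_eq_div] using (one_le_div hb).2 (hby i)
    · have := hC.2 i₀
      simp only [Pi.one_apply, Pi.smul_apply, smul_eq_mul, h₀] at this
      rwa [inv_le_iff_one_le_mul₀ hb]
  rw [hilbertDist, if_neg hne, if_pos hcomp, hU, hL, div_eq_mul_inv]

/-- A map that fixes `1` and whose Birkhoff ratio is less than `s⁻¹` has only constant
positive solutions `y` of `F (y ^ s) = N • y`. -/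
lemma eq_const_of_birkhoffRatio_lt [Finite ι] [Nonempty ι] {F : (ι → ℝ) → ι → ℝ} (hF : F 1 = 1)
    {s N : ℝ} (hs : 0 < s) (hN : 0 < N) {y : ι → ℝ} (hy : ∀ i, 0 < y i)
    (hfix : F (fun i => y i ^ s) = N • y) (hratio : birkhoffRatio F < (ENNReal.ofReal s)⁻¹) :
    ∃ c, 0 < c ∧ ∀ i, y i = c := by
  obtain ⟨K, ⟨C, hC, rfl, hlip⟩, hK⟩ := sInf_lt_iff.1 hratio
  obtain ⟨i₀, h₀⟩ := Finite.exists_min y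
  obtain ⟨i₁, h₁⟩ := Finite.exists_max y
  have hCs : C * s < 1 := by
    rw [← ENNReal.ofReal_inv_of_pos hs, ENNReal.ofReal_lt_ofReal_iff (inv_pos.2 hs)] at hK
    simpa [hs.ne'] using mul_lt_mul_of_pos_right hK hs
  have hb := hy i₀
  have hz := hilbertDist_one (y := fun i => y i ^ s) (Real.rpow_pos_of_pos hb s) (i₀ := i₀)
    (i₁ := i₁) rfl rfl (fun i => Real.rpow_le_rpow hb.le (h₀ i) hs.le)
    (fun i => Real.rpow_le_rpow (hy i).le (h₁ i) hs.le)
  have hNy := hilbertDist_one (y := N • y) (b := N * y i₀) (a := N * y i₁) (i₀ := i₀)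
    (i₁ := i₁) (mul_pos hN hb) rfl rfl (fun i => mul_le_mul_of_nonneg_left (h₀ i) hN.le)
    (fun i => mul_le_mul_of_nonneg_left (h₁ i) hN.le)
  have hcomp : Comparable (fun i => y i ^ s) 1 :=
    ⟨fun i => (Real.rpow_pos_of_pos (hy i) s).le, fun _ => zero_le_one, y i₀ ^ s, y i₁ ^ s,
      Real.rpow_pos_of_pos hb s, Real.rpow_pos_of_pos (hy i₁) s,
      fun i => by simpa using Real.rpow_le_rpow hb.le (h₀ i) hs.le,
      fun i => by simpa using Real.rpow_le_rpow (hy i).le (h₁ i) hs.le⟩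
  have key := hlip _ _ hcomp
  have hab : 1 ≤ y i₁ / y i₀ := (one_le_div hb).2 (h₀ i₁)
  have hlog : 0 ≤ Real.log (y i₁ / y i₀) := Real.log_nonneg hab
  rw [hfix, hF, hz, hNy, mul_div_mul_left _ _ hN.ne', ← Real.div_rpow (hy i₁).le hb.le,
    Real.log_rpow (by linarith), ← ENNReal.ofReal_mul hC.le,
    ENNReal.ofReal_le_ofReal_iff (by positivity)] at key
  -- Here `key` reads `log ≤ C * (s * log)`, with `C * s < 1` and `log ≥ 0`.
  have hzero : Real.log (y i₁ / y i₀) = 0 := by nlinarith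
  have hle : y i₁ ≤ y i₀ := by
    rcases Real.log_eq_zero.1 hzero with h | h | h
    · linarith
    · exact ((div_eq_one_iff_eq hb.ne').1 h).le
    · linarith
  exact ⟨y i₀, hb, fun i => le_antisymm ((h₁ i).trans hle) (h₀ i)⟩

end Hilbert

/-! ### The adjoint, and positivity from irreducibility. -/

section Adjoint

variable {ι : Type*} [Fintype ι] [DecidableEq ι] {π : ι → ℝ} {M : Matrix ι ι ℝ}

lemma weightedAdjoint_apply (hπ : ∀ i, 0 < π i) (i j : ι) :
    weightedAdjoint π M i j = (π i)⁻¹ * M j i * π j := by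
  have hunit : IsUnit π := Pi.isUnit_iff.2 fun i => (hπ i).ne'.isUnit
  have hinv : Ring.inverse π i = (π i)⁻¹ := by
    have := congrFun (Ring.mul_inverse_cancel π hunit) i
    exact eq_inv_of_mul_eq_one_right this
  rw [weightedAdjoint, Matrix.mul_diagonal, Matrix.inv_diagonal, Matrix.diagonal_mul, hinv,
    Matrix.transpose_apply]

/-- `⟨M^* z, x⟩_π = ⟨z, M x⟩_π`. -/
lemma sum_weightedAdjoint_mulVec (hπ : ∀ i, 0 < π i) (z x : ι → ℝ) :
    ∑ i, π i * ((weightedAdjoint π M).mulVec z i * x i) = ∑ i, π i * (z i * M.mulVec x i) := by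
  simp only [Matrix.mulVec, dotProduct, weightedAdjoint_apply hπ, Finset.sum_mul, Finset.mul_sum]
  rw [Finset.sum_comm]
  refine Finset.sum_congr rfl fun j _ => Finset.sum_congr rfl fun i _ => ?_
  have := (hπ i).ne'
  field_simp

lemma weightedAdjoint_mulVec_one (hπ : ∀ i, 0 < π i) (hstat : Matrix.vecMul π M = π) :
    (weightedAdjoint π M).mulVec 1 = 1 := by
  ext i
  have h := congrFun hstat i
  simp only [Matrix.vecMul, dotProduct] at h
  simp only [Matrix.mulVec, dotProduct, weightedAdjoint_apply hπ, Pi.one_apply, mul_one, mul_assoc,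
    ← Finset.mul_sum]
  simp only [mul_comm (M _ i), h]
  exact inv_mul_cancel₀ (hπ i).ne'

/-- A nonnegative vector `y ≠ 0` whose zeros are preserved by an irreducible matrix, in the sense
that `A z = N y` for a nonnegative `z` with the support of `y`, is positive. -/
lemma pos_of_isIrreducible {A : Matrix ι ι ℝ} (hA : A.IsIrreducible) {y z : ι → ℝ} {N : ℝ}
    (hy : ∀ i, 0 ≤ y i) (hy0 : y ≠ 0) (hz : ∀ i, 0 ≤ z i) (hzy : ∀ i, z i = 0 → y i = 0)
    (h : A.mulVec z = N • y) (i : ι) : 0 < y i := by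
  by_contra hi
  obtain ⟨k, hk⟩ : ∃ k, y k ≠ 0 := Function.ne_iff.1 hy0
  have hzero : ∀ j l, y j = 0 → y l ≠ 0 → A j l = 0 := by
    intro j l hj hl
    have hsum : ∑ m, A j m * z m = 0 := by
      simpa [Matrix.mulVec, dotProduct, hj] using congrFun h j
    have := (Finset.sum_eq_zero_iff_of_nonneg
      (fun m _ => mul_nonneg (hA.nonneg j m) (hz m))).1 hsum l (Finset.mem_univ l)
    exact (mul_eq_zero.1 this).resolve_right fun hl' => hl (hzy l hl')
  -- No path leads from a zero of `y` to its support, whereas irreducibility supplies one from `i`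
  -- to `k`.
  have hpow : ∀ m : ℕ, ∀ j l, y j = 0 → y l ≠ 0 → (A ^ m) j l = 0 := by
    intro m
    induction m with
    | zero =>
      intro j l hj hl
      rw [pow_zero, Matrix.one_apply_ne]
      rintro rfl
      exact hl hj
    | succ m ih =>
      intro j l hj hl
      rw [pow_succ, Matrix.mul_apply]
      refine Finset.sum_eq_zero fun p _ => ?_
      by_cases hp : y p = 0
      · rw [hzero p l hp hl, mul_zero]
      · rw [ih j p hj hp, zero_mul]
  obtain ⟨m, -, hm⟩ := (Matrix.isIrreducible_iff_exists_pow_pos hA.nonneg).1 hA i k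
  exact hm.ne' (hpow m i k (le_antisymm (not_lt.1 hi) (hy i)) hk)

end Adjoint

/-! ### The extremal problem and the norm bound. -/

section Norm

variable {ι : Type*} [Fintype ι] {π : ι → ℝ} {M : Matrix ι ι ℝ}

/-- The nonnegative part of the unit sphere of `‖·‖_{π,2}` is compact. -/
lemma isCompact_weightedSphere (hπ : ∀ i, 0 < π i) :
    IsCompact {x : ι → ℝ | 0 ≤ x ∧ ∑ i, π i * x i ^ 2 = 1} := by
  -- The crude bound `t ≤ t ^ 2 + 1` avoids a square root.
  refine (isCompact_Icc (a := (0 : ι → ℝ)) (b := fun i => (π i)⁻¹ + 1)).of_isClosed_subset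
    (isClosed_Ici.inter (isClosed_eq (by fun_prop) continuous_const)) ?_
  rintro x ⟨hx, hx1⟩
  refine ⟨hx, fun i => ?_⟩
  have h : π i * x i ^ 2 ≤ 1 := hx1 ▸ Finset.single_le_sum (f := fun i => π i * x i ^ 2)
    (fun j _ => mul_nonneg (hπ j).le (sq_nonneg _)) (Finset.mem_univ i)
  have h' : x i ^ 2 ≤ (π i)⁻¹ := by
    rwa [← one_div, le_div_iff₀ (hπ i), mul_comm]
  nlinarith [sq_nonneg (x i - 1), hx i]

/-- The strict bound on the ratio is what forces a maximizer to be constant; the boundary exponent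
is reached afterwards as a limit. -/
lemma weightedSum_le_one_of_lt [DecidableEq ι] [Nonempty ι]
    (hM0 : ∀ i j, 0 ≤ M i j) (hM1 : M.mulVec 1 = 1) (hπ : ∀ i, 0 < π i)
    (hsum : ∑ i, π i = 1) (hstat : Matrix.vecMul π M = π)
    (hirr : (M * weightedAdjoint π M).IsIrreducible) {r : ℝ} (hr : 1 < r)
    (hratio : matrixBirkhoffRatio (M * weightedAdjoint π M) < (ENNReal.ofReal (r - 1))⁻¹)
    {x : ι → ℝ} (hx0 : 0 ≤ x) (hx1 : ∑ i, π i * x i ^ 2 = 1) :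
    ∑ i, π i * M.mulVec x i ^ r ≤ 1 := by
  set W := weightedAdjoint π M
  have hr0 : 0 < r := by linarith
  have hMnn : ∀ x : ι → ℝ, 0 ≤ x → ∀ i, 0 ≤ M.mulVec x i := fun x hx i =>
    Finset.sum_nonneg fun j _ => mul_nonneg (hM0 i j) (hx j)
  have hone : (1 : ι → ℝ) ∈ {x : ι → ℝ | 0 ≤ x ∧ ∑ i, π i * x i ^ 2 = 1} :=
    ⟨fun _ => zero_le_one, by simpa using hsum⟩
  have hcont : Continuous fun x : ι → ℝ => ∑ i, π i * M.mulVec x i ^ r := by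
    refine continuous_finsetSum _ fun i _ => continuous_const.mul ?_
    have : Continuous fun x : ι → ℝ => M.mulVec x i := by
      simp only [Matrix.mulVec, dotProduct]; fun_prop
    exact this.rpow_const fun _ => Or.inr hr0.le
  obtain ⟨u, ⟨hu0, hu1⟩, hmax⟩ :=
    (isCompact_weightedSphere hπ).exists_isMaxOn ⟨1, hone⟩ hcont.continuousOn
  refine (hmax (show x ∈ _ from ⟨hx0, hx1⟩)).trans ?_
  change ∑ i, π i * M.mulVec u i ^ r ≤ 1
  have hy := hMnn u hu0
  set y := M.mulVec u with hy_def
  let z : ι → ℝ := fun i => y i ^ (r - 1)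
  -- Up to the factor `r`, this is the gradient of the objective at `u` for `⟨·, ·⟩_π`.
  set g := W.mulVec z with hg
  have hz0 : ∀ i, 0 ≤ z i := fun i => Real.rpow_nonneg (hy i) _
  have hzy : ∀ i, z i * y i = y i ^ r := fun i => by
    rcases (hy i).eq_or_lt with h | h
    · simp [z, ← h, Real.zero_rpow hr0.ne']
    · simp only [z]
      rw [← Real.rpow_add_one h.ne']; simp
  have hg0 : ∀ i, 0 ≤ g i := fun i => Finset.sum_nonneg fun j _ => by
    have hWij : 0 ≤ W i j := by
      rw [show W i j = _ from weightedAdjoint_apply hπ i j]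
      exact mul_nonneg (mul_nonneg (inv_pos.2 (hπ i)).le (hM0 j i)) (hπ j).le
    exact mul_nonneg hWij (hz0 j)
  have hgu : ∑ i, π i * (g i * u i) = ∑ i, π i * y i ^ r := by
    rw [hg, sum_weightedAdjoint_mulVec hπ]
    simp only [← hy_def, hzy]
  have hge1 : 1 ≤ ∑ i, π i * y i ^ r := by
    have : ∑ i, π i * M.mulVec 1 i ^ r ≤ _ := hmax hone
    simpa [hM1, hsum] using this
  -- The convexity of `t ↦ t ^ r` and the maximality of `u`.
  have hle : ∀ v : ι → ℝ, 0 ≤ v → ∑ i, π i * v i ^ 2 = 1 →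
      ∑ i, π i * (g i * v i) ≤ ∑ i, π i * (g i * u i) := by
    intro v hv0 hv1
    have h₁ : ∑ i, π i * M.mulVec v i ^ r ≤ ∑ i, π i * y i ^ r :=
      hmax (show v ∈ _ from ⟨hv0, hv1⟩)
    have h₂ : ∑ i, π i * (y i ^ r + r * (z i * (M.mulVec v i - y i))) ≤
        ∑ i, π i * M.mulVec v i ^ r :=
      Finset.sum_le_sum fun i _ =>
        mul_le_mul_of_nonneg_left (rpow_tangent_le hr (hy i) (hMnn v hv0 i)) (hπ i).le
    have h₃ : ∑ i, π i * (y i ^ r + r * (z i * (M.mulVec v i - y i))) =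
        ∑ i, π i * y i ^ r + r * (∑ i, π i * (g i * v i) - ∑ i, π i * (g i * u i)) := by
      rw [hg, sum_weightedAdjoint_mulVec hπ, sum_weightedAdjoint_mulVec hπ,
        ← Finset.sum_sub_distrib, Finset.mul_sum, ← Finset.sum_add_distrib]
      exact Finset.sum_congr rfl fun i _ => by rw [← hy_def]; ring
    nlinarith
  -- Hence `g` is a positive multiple of `u`.
  set N := √(∑ i, π i * g i ^ 2) with hN_def
  have hNsq : N ^ 2 = ∑ i, π i * g i ^ 2 :=
    Real.sq_sqrt (Finset.sum_nonneg fun i _ => mul_nonneg (hπ i).le (sq_nonneg _))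
  have hNpos : 0 < N := by
    refine (Real.sqrt_nonneg _).lt_of_ne fun h => ?_
    have hN0 : ∑ i, π i * g i ^ 2 = 0 := by
      rw [← hNsq, hN_def, ← h, zero_pow two_ne_zero]
    have hgz : ∀ i, g i = 0 := fun i => by
      have := (Finset.sum_eq_zero_iff_of_nonneg
        (fun m _ => mul_nonneg (hπ m).le (sq_nonneg (g m)))).1 hN0 i (Finset.mem_univ i)
      simpa [(hπ i).ne'] using this
    simp only [hgz, zero_mul, mul_zero, Finset.sum_const_zero] at hgu
    linarith
  -- Testing maximality on `g / N` reverses Cauchy–Schwarz, since `‖u‖_{π,2} = 1`.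
  have hNle : N ≤ ∑ i, π i * (g i * u i) := by
    refine le_trans (le_of_eq ?_) (hle (fun i => g i / N)
      (fun i => div_nonneg (hg0 i) hNpos.le) ?_)
    · have : ∑ i, π i * (g i * (g i / N)) = (∑ i, π i * g i ^ 2) / N := by
        rw [Finset.sum_div]; exact Finset.sum_congr rfl fun i _ => by ring
      rw [this, ← hNsq]; field_simp
    · have : ∑ i, π i * (g i / N) ^ 2 = (∑ i, π i * g i ^ 2) / N ^ 2 := by
        rw [Finset.sum_div]; exact Finset.sum_congr rfl fun i _ => by ring
      rw [this, ← hNsq]; field_simp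
  have hgNu : g = N • u := by
    -- `‖g - N u‖² = 2 N² - 2 N ⟨g, u⟩_π ≤ 0`.
    have hexp : ∑ i, π i * (g i - N * u i) ^ 2 =
        ∑ i, π i * g i ^ 2 - 2 * N * ∑ i, π i * (g i * u i) + N ^ 2 * ∑ i, π i * u i ^ 2 := by
      rw [Finset.mul_sum, Finset.mul_sum, ← Finset.sum_sub_distrib, ← Finset.sum_add_distrib]
      exact Finset.sum_congr rfl fun i _ => by ring
    have hnn : ∀ i ∈ Finset.univ, 0 ≤ π i * (g i - N * u i) ^ 2 :=
      fun i _ => mul_nonneg (hπ i).le (sq_nonneg _)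
    have hz : ∑ i, π i * (g i - N * u i) ^ 2 = 0 := by
      refine le_antisymm ?_ (Finset.sum_nonneg hnn)
      rw [hexp, ← hNsq, hu1]
      nlinarith
    ext i
    have := (Finset.sum_eq_zero_iff_of_nonneg hnn).1 hz i (Finset.mem_univ i)
    have := (mul_eq_zero.1 this).resolve_left (hπ i).ne'
    simpa [sub_eq_zero] using this
  have hfix : (M * W).mulVec z = N • y := by
    rw [← Matrix.mulVec_mulVec, ← hg, hgNu, Matrix.mulVec_smul]
  have hy_ne : y ≠ 0 := fun h => by
    simp only [h, Pi.zero_apply, Real.zero_rpow hr0.ne', mul_zero, Finset.sum_const_zero] at hge1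
    linarith
  have hypos := pos_of_isIrreducible hirr hy hy_ne hz0
    (fun i hi => by
      by_contra hyi
      exact (Real.rpow_pos_of_pos ((hy i).lt_of_ne' hyi) (r - 1)).ne' hi) hfix
  have hW1 : W.mulVec 1 = 1 := weightedAdjoint_mulVec_one hπ hstat
  obtain ⟨c, hc, hyc⟩ := eq_const_of_birkhoffRatio_lt (F := fun x => (M * W).mulVec x)
    (by simp only [← Matrix.mulVec_mulVec, hW1, hM1]) (sub_pos.2 hr) hNpos hypos hfix hratio
  -- So `u` is constant, and therefore `u = 1`.
  have hz_const : z = c ^ (r - 1) • (1 : ι → ℝ) := by ext i; simp [z, hyc]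
  -- `M` need not be injective, so `u` is recovered from `N u = M^* z` and not from `M u = y`.
  have hu_const : ∀ i, u i = c ^ (r - 1) / N := fun i => by
    have h : g = c ^ (r - 1) • (1 : ι → ℝ) := by rw [hg, hz_const, Matrix.mulVec_smul, hW1]
    rw [eq_div_iff hNpos.ne', mul_comm]
    simpa using congrFun (hgNu.symm.trans h) i
  set d := c ^ (r - 1) / N
  have hd0 : 0 ≤ d := by
    obtain ⟨i⟩ := ‹Nonempty ι›
    exact hu_const i ▸ hu0 i
  have hd : d = 1 := by
    simp only [hu_const, ← Finset.sum_mul, hsum, one_mul] at hu1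
    exact (pow_eq_one_iff_of_nonneg hd0 two_ne_zero).1 hu1
  have hu : u = 1 := funext fun i => (hu_const i).trans hd
  rw [hy_def, hu, hM1]
  simp [hsum]

/-- `∑ i, π i |M x|_i ^ q ≤ 1` on the nonnegative unit sphere, for all admissible `q`. -/
lemma weightedSum_le_one [DecidableEq ι] [Nonempty ι]
    (hM0 : ∀ i j, 0 ≤ M i j) (hM1 : M.mulVec 1 = 1) (hπ : ∀ i, 0 < π i)
    (hsum : ∑ i, π i = 1) (hstat : Matrix.vecMul π M = π)
    (hirr : (M * weightedAdjoint π M).IsIrreducible) {q : ℝ} (hq₁ : 1 ≤ q)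
    (hq₂ : ENNReal.ofReal q ≤ 1 + (matrixBirkhoffRatio (M * weightedAdjoint π M))⁻¹)
    {x : ι → ℝ} (hx0 : 0 ≤ x) (hx1 : ∑ i, π i * x i ^ 2 = 1) :
    ∑ i, π i * M.mulVec x i ^ q ≤ 1 := by
  have hMx : ∀ i, 0 ≤ M.mulVec x i := fun i =>
    Finset.sum_nonneg fun j _ => mul_nonneg (hM0 i j) (hx0 j)
  rcases hq₁.eq_or_lt with rfl | hq
  -- At `q = 1` no `1 < r < q` exists; instead `M` preserves the `π`-mean, and `t ≤ (t ^ 2 + 1) /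
  -- 2`.
  · have h : ∑ i, π i * M.mulVec x i = ∑ i, π i * x i := by
      change π ⬝ᵥ M.mulVec x = π ⬝ᵥ x
      rw [Matrix.dotProduct_mulVec, hstat]
    simp only [Real.rpow_one, h]
    have hsq : ∑ i, π i * x i ≤ ∑ i, π i * ((x i ^ 2 + 1) / 2) :=
      Finset.sum_le_sum fun i _ =>
        mul_le_mul_of_nonneg_left (by nlinarith [sq_nonneg (x i - 1)]) (hπ i).le
    refine hsq.trans (le_of_eq ?_)
    calc ∑ i, π i * ((x i ^ 2 + 1) / 2) = (∑ i, π i * x i ^ 2 + ∑ i, π i) / 2 := by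
          rw [← Finset.sum_add_distrib, Finset.sum_div]
          exact Finset.sum_congr rfl fun i _ => by ring
      _ = 1 := by rw [hx1, hsum]; norm_num
  · have hlim : Filter.Tendsto (fun r : ℝ => ∑ i, π i * M.mulVec x i ^ r)
        (nhdsWithin q (Set.Iio q)) (nhds (∑ i, π i * M.mulVec x i ^ q)) := by
      refine tendsto_nhdsWithin_of_tendsto_nhds (tendsto_finsetSum _ fun i _ =>
        tendsto_const_nhds.mul ?_)
      have : ContinuousAt (fun r : ℝ => M.mulVec x i ^ r) q :=
        continuousAt_const.rpow continuousAt_id (Or.inr (zero_lt_one.trans hq))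
      exact this
    refine le_of_tendsto hlim ?_
    filter_upwards [Ioo_mem_nhdsLT hq] with r hr
    refine weightedSum_le_one_of_lt hM0 hM1 hπ hsum hstat hirr hr.1 ?_ hx0 hx1
    -- In `[0, ∞]` this form, `r - 1 < κ⁻¹`, also covers `κ = 0`.
    rw [← ENNReal.lt_inv_iff_lt_inv]
    have hq' : ENNReal.ofReal q = 1 + ENNReal.ofReal (q - 1) := by
      rw [← ENNReal.ofReal_one, ← ENNReal.ofReal_add zero_le_one (by linarith)]; simp
    rw [hq', ENNReal.add_le_add_iff_left ENNReal.one_ne_top] at hq₂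
    refine lt_of_lt_of_le ?_ hq₂
    rw [ENNReal.ofReal_lt_ofReal_iff (by linarith)]
    linarith [hr.2]

lemma weightedNorm_smul (hπ : ∀ i, 0 < π i) {p : ℝ} (hp : 0 < p) (c : ℝ) (x : ι → ℝ) :
    weightedNorm π p (c • x) = |c| * weightedNorm π p x := by
  have h : ∑ i, π i * |(c • x) i| ^ p = |c| ^ p * ∑ i, π i * |x i| ^ p := by
    rw [Finset.mul_sum]
    refine Finset.sum_congr rfl fun i _ => ?_
    rw [Pi.smul_apply, smul_eq_mul, abs_mul, Real.mul_rpow (abs_nonneg _) (abs_nonneg _)]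
    ring
  rw [weightedNorm, h, Real.mul_rpow (by positivity)
    (Finset.sum_nonneg fun i _ => mul_nonneg (hπ i).le (by positivity)),
    ← Real.rpow_mul (abs_nonneg c), mul_one_div_cancel hp.ne', Real.rpow_one, weightedNorm]

lemma weightedNorm_pos (hπ : ∀ i, 0 < π i) {p : ℝ} {x : ι → ℝ} (hx : x ≠ 0) :
    0 < weightedNorm π p x := by
  obtain ⟨i, hi⟩ := Function.ne_iff.1 hx
  have hsum : 0 < ∑ j, π j * |x j| ^ p :=
    Finset.sum_pos' (fun j _ => mul_nonneg (hπ j).le (by positivity))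
      ⟨i, Finset.mem_univ i, mul_pos (hπ i) (Real.rpow_pos_of_pos (abs_pos.2 hi) p)⟩
  exact Real.rpow_pos_of_pos hsum _

lemma weightedNorm_mono (hπ : ∀ i, 0 < π i) {p : ℝ} (hp : 0 < p) {x y : ι → ℝ}
    (h : ∀ i, |x i| ≤ |y i|) : weightedNorm π p x ≤ weightedNorm π p y :=
  Real.rpow_le_rpow (Finset.sum_nonneg fun i _ => mul_nonneg (hπ i).le (by positivity))
    (Finset.sum_le_sum fun i _ => mul_le_mul_of_nonneg_left
      (Real.rpow_le_rpow (abs_nonneg _) (h i) hp.le) (hπ i).le) (by positivity)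

lemma weightedNorm_abs (p : ℝ) (x : ι → ℝ) : weightedNorm π p |x| = weightedNorm π p x := by
  simp [weightedNorm]

lemma weightedNorm_one (hsum : ∑ i, π i = 1) (p : ℝ) : weightedNorm π p 1 = 1 := by
  simp [weightedNorm, hsum]

lemma abs_mulVec_le (hM0 : ∀ i j, 0 ≤ M i j) (x : ι → ℝ) (i : ι) :
    |M.mulVec x i| ≤ |M.mulVec |x| i| := by
  refine le_trans ((Finset.abs_sum_le_sum_abs _ _).trans (le_of_eq ?_)) (le_abs_self _)
  exact Finset.sum_congr rfl fun j _ => by rw [abs_mul, abs_of_nonneg (hM0 i j)]; rfl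

/-- Homogeneity and `|M x| ≤ M |x|` reduce this to nonnegative unit vectors. -/
lemma weightedNorm_mulVec_le [DecidableEq ι] [Nonempty ι]
    (hM0 : ∀ i j, 0 ≤ M i j) (hM1 : M.mulVec 1 = 1) (hπ : ∀ i, 0 < π i)
    (hsum : ∑ i, π i = 1) (hstat : Matrix.vecMul π M = π)
    (hirr : (M * weightedAdjoint π M).IsIrreducible) {q : ℝ} (hq₁ : 1 ≤ q)
    (hq₂ : ENNReal.ofReal q ≤ 1 + (matrixBirkhoffRatio (M * weightedAdjoint π M))⁻¹)
    {x : ι → ℝ} (hx : x ≠ 0) :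
    weightedNorm π q (M.mulVec x) ≤ weightedNorm π 2 x := by
  have hq0 : 0 < q := by linarith
  set c := weightedNorm π 2 x
  have hc : 0 < c := weightedNorm_pos hπ hx
  have hv0 : 0 ≤ c⁻¹ • |x| := smul_nonneg (inv_pos.2 hc).le (abs_nonneg x)
  have hv1 : weightedNorm π 2 (c⁻¹ • |x|) = 1 := by
    rw [weightedNorm_smul hπ two_pos, weightedNorm_abs, abs_of_pos (inv_pos.2 hc)]
    exact inv_mul_cancel₀ hc.ne'
  have hv2 : ∑ i, π i * (c⁻¹ • |x|) i ^ 2 = 1 := by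
    rw [weightedNorm, ← Real.sqrt_eq_rpow, Real.sqrt_eq_one] at hv1
    simpa only [Real.rpow_two, sq_abs] using hv1
  have key := weightedSum_le_one hM0 hM1 hπ hsum hstat hirr hq₁ hq₂ hv0 hv2
  have hMv : ∀ i, 0 ≤ M.mulVec (c⁻¹ • |x|) i := fun i =>
    Finset.sum_nonneg fun j _ => mul_nonneg (hM0 i j) (hv0 j)
  have hnorm : weightedNorm π q (M.mulVec (c⁻¹ • |x|)) ≤ 1 := by
    refine Real.rpow_le_one (Finset.sum_nonneg fun i _ =>
      mul_nonneg (hπ i).le (by positivity)) ?_ (by positivity)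
    simpa only [abs_of_nonneg (hMv _)] using key
  rw [Matrix.mulVec_smul, weightedNorm_smul hπ hq0, abs_of_pos (inv_pos.2 hc),
    inv_mul_le_iff₀ hc, mul_one] at hnorm
  exact (weightedNorm_mono hπ hq0 (abs_mulVec_le hM0 x)).trans hnorm

end Norm

end MarkovNorm

/-- The first conjunct says that the maximum that defines `‖M‖_{π,2→q}` exists and is `1`. The
range of `q` is taken in `[0, ∞]`, where `0⁻¹ = ∞`. -/
theorem mainTheorem9 {n : ℕ} (M : Matrix (Fin n) (Fin n) ℝ) (π : Fin n → ℝ)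
    (hM : M ∈ Matrix.rowStochastic ℝ (Fin n))
    (hπ_pos : ∀ i, 0 < π i) (hπ_sum : ∑ i, π i = 1)
    (hπ_stat : Matrix.vecMul π M = π)
    (hirr : (M * MarkovNorm.weightedAdjoint π M).IsIrreducible)
    (q : ℝ) (hq₁ : 1 ≤ q)
    (hq₂ : ENNReal.ofReal q ≤
      1 + (MarkovNorm.matrixBirkhoffRatio (M * MarkovNorm.weightedAdjoint π M))⁻¹) :
    IsGreatest (MarkovNorm.weightedQuotients π 2 q M) 1 ∧
      MarkovNorm.weightedOpNorm π 2 q M = 1 := by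
  have hne : Nonempty (Fin n) := by
    by_contra h
    rw [not_nonempty_iff] at h
    simp at hπ_sum
  obtain ⟨hM0, hM1⟩ := Matrix.mem_rowStochastic.1 hM
  have hgreatest : IsGreatest (MarkovNorm.weightedQuotients π 2 q M) 1 := by
    refine ⟨⟨1, one_ne_zero, ?_⟩, ?_⟩
    · rw [hM1, MarkovNorm.weightedNorm_one hπ_sum, MarkovNorm.weightedNorm_one hπ_sum, div_one]
    · rintro _ ⟨x, hx, rfl⟩
      exact (div_le_one (MarkovNorm.weightedNorm_pos hπ_pos hx)).2
        (MarkovNorm.weightedNorm_mulVec_le hM0 hM1 hπ_pos hπ_sum hπ_stat hirr hq₁ hq₂ hx)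
  exact ⟨hgreatest, hgreatest.csSup_eq⟩
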